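/- Let $S_3$ act on $\mathbb{P}^2_{\mathbb{C}}$ by permuting the homogeneous coordinates. Let $f,g\in\mathbb{C}[X_0,X_1,X_2]$ be nonzero symmetric homogeneous polynomials of degrees $d\ge 1$ and $e\ge 1$, with corresponding symmetric curves $C=V(f)$ and $D=V(g)$ in $\mathbb{P}^2_{\mathbb{C}}$. Assume that $C$ and $D$ are transverse: at every common point $P$ of $C$ and $D$ both curves are smooth with distinct tangent lines, i.e. the vectors $\nabla f(P)$ and $\nabla g(P)$ in $\mathbb{C}^3$ are linearly independent. Let $C_2\subset S_3$ be a subgroup generated by a transposition and $C_3\subset S_3$ the subgroup generated by a $3$-cycle, and write $[S_3/H]$ for the isomorphism class of the transitive $S_3$-set $S_3/H$, $[S_3]$ for that of $S_3$ acting on itself by left multiplication, and $+$ for disjoint union. Then for every integer $k\ge 0$: - if $de=6k$, then $C\cap D\cong k[S_3]$ as an $S_3$-set; - $de\ne 6k+1$ (no transverse intersection with such degrees exists); - if $de=6k+2$, then $C\cap D\cong k[S_3]+[S_3/C_3]$; - if $de=6k+3$, then $C\cap D\cong k[S_3]+[S_3/C_2]$; - $de\ne 6k+4$ (no transverse intersection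 with such degrees exists); - if $de=6k+5$, then $C\cap D\cong k[S_3]+[S_3/C_2]+[S_3/C_3]$. -/

import Mathlib

namespace SymmetricBezout

open MvPolynomial
open scoped LinearAlgebra.Projectivization

/-- The symmetric group on three letters. -/
abbrev S3 : Type := Equiv.Perm (Fin 3)

/-- The complex projective plane, as the set of lines in `ℂ³`. -/
abbrev P2 : Type := ℙ ℂ (Fin 3 → ℂ)

/-- `σ` permutes the coordinates of `ℂ³`: the `i`-th coordinate of the image of `v` is
the `σ⁻¹ i`-th coordinate of `v`. -/
noncomputable def permCoords (σ : S3) : (Fin 3 → ℂ) →ₗ[ℂ] (Fin 3 → ℂ) :=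
  LinearMap.funLeft ℂ ℂ (⇑σ⁻¹)

@[simp] theorem permCoords_apply (σ : S3) (v : Fin 3 → ℂ) (i : Fin 3) :
    permCoords σ v i = v (σ⁻¹ i) := rfl

theorem permCoords_injective (σ : S3) : Function.Injective (permCoords σ) :=
  LinearMap.funLeft_injective_of_surjective ℂ ℂ _ (σ⁻¹).surjective

/-- The left action of `S3` on the projective plane that permutes the homogeneous coordinates. -/
noncomputable instance permAction : MulAction S3 P2 where
  smul σ P := Projectivization.map (permCoords σ) (permCoords_injective σ) P
  one_smul P := by
    induction P using Projectivization.ind with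
    | h v hv => rfl
  mul_smul σ τ P := by
    induction P using Projectivization.ind with
    | h v hv => rfl

theorem smul_def (σ : S3) (P : P2) :
    σ • P = Projectivization.map (permCoords σ) (permCoords_injective σ) P := rfl

/-- The zero locus in the projective plane of a homogeneous polynomial: the lines in `ℂ³` on
which the polynomial vanishes. -/
def zeroLocus (f : MvPolynomial (Fin 3) ℂ) : Set P2 :=
  {P | ∀ v ∈ P.submodule, eval v f = 0}

/-- For homogeneous polynomials, vanishing at a point can be tested on any homogeneous
coordinates of that point. -/
theorem mk_mem_zeroLocus_iff {f : MvPolynomial (Fin 3) ℂ} {d : ℕ} (hf : f.IsHomogeneous d)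
    (v : Fin 3 → ℂ) (hv : v ≠ 0) :
    Projectivization.mk ℂ v hv ∈ zeroLocus f ↔ eval v f = 0 := by
  constructor
  · intro h
    exact h v (by rw [Projectivization.submodule_mk]; exact Submodule.mem_span_singleton_self v)
  · intro h w hw
    rw [Projectivization.submodule_mk, Submodule.mem_span_singleton] at hw
    obtain ⟨c, rfl⟩ := hw
    have hc : eval (c • v) f = c ^ d * eval v f := by
      rw [eval_eq', eval_eq', Finset.mul_sum]
      refine Finset.sum_congr rfl fun m hm => ?_
      have hdeg := hf (mem_support_iff.mp hm)
      have hsum : ∑ i, m i = d := by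
        rw [← hdeg, ← Finsupp.degree_eq_sum, Finsupp.degree_eq_weight_one]
        rfl
      simp only [Pi.smul_apply, smul_eq_mul, mul_pow, Finset.prod_mul_distrib,
        Finset.prod_pow_eq_pow_sum]
      rw [hsum]
      ring
    rw [hc, h, mul_zero]

/-- The intersection of the zero loci of two symmetric polynomials, with the action of `S3`
inherited from the projective plane. -/
noncomputable def intersectionLocus (f g : MvPolynomial (Fin 3) ℂ) (hf : f.IsSymmetric) (hg : g.IsSymmetric) :
    SubMulAction S3 P2 where
  carrier := zeroLocus f ∩ zeroLocus g
  smul_mem' := by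
    have key : ∀ h : MvPolynomial (Fin 3) ℂ, h.IsSymmetric → ∀ (σ : S3) (P : P2),
        P ∈ zeroLocus h → σ • P ∈ zeroLocus h := by
      intro h hh σ P hP
      induction P using Projectivization.ind with
      | h v hv =>
        intro w hw
        rw [smul_def, Projectivization.map_mk, Projectivization.submodule_mk,
          Submodule.mem_span_singleton] at hw
        obtain ⟨c, rfl⟩ := hw
        have h1 := hP (c • v) (by
          rw [Projectivization.submodule_mk]
          exact Submodule.smul_mem _ _ (Submodule.mem_span_singleton_self v))
        rw [← hh σ⁻¹, eval_rename] at h1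
        exact h1
    exact fun σ P hP => ⟨key f hf σ P hP.1, key g hg σ P hP.2⟩

/-- The vector of partial derivatives of `f` at `v`. -/
noncomputable def gradVec (f : MvPolynomial (Fin 3) ℂ) (v : Fin 3 → ℂ) : Fin 3 → ℂ :=
  fun i => eval v (pderiv i f)

/-- The projective plane curves `f = 0` and `g = 0` are transverse: at each common point both are
smooth and their tangent lines, whose coefficients are the partial derivatives, are distinct. -/
def Transverse (f g : MvPolynomial (Fin 3) ℂ) : Prop :=
  ∀ v : Fin 3 → ℂ, v ≠ 0 → eval v f = 0 → eval v g = 0 →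
    LinearIndependent ℂ ![gradVec f v, gradVec g v]

/-- The subgroup of order two generated by a transposition. -/
def C2 : Subgroup S3 := Subgroup.zpowers (Equiv.swap 0 1)

/-- The subgroup of order three generated by a three-cycle. -/
def C3 : Subgroup S3 := Subgroup.zpowers (finRotate 3)

/-- The `S3`-set `k[S3] + a[S3/C2] + b[S3/C3]`: the disjoint union of `k` copies of `S3`, `a`
copies of `S3/C2` and `b` copies of `S3/C3`, with `S3` acting on each copy by left
multiplication. -/
abbrev OrbitSum (k a b : ℕ) : Type :=
  (Σ _ : Fin k, S3) ⊕ (Σ _ : Fin a, S3 ⧸ C2) ⊕ (Σ _ : Fin b, S3 ⧸ C3)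

/-- Two `S3`-sets are isomorphic: there is an equivariant bijection between them. -/
def Isomorphic (X Y : Type) [MulAction S3 X] [MulAction S3 Y] : Prop :=
  ∃ φ : X ≃ Y, ∀ (σ : S3) (x : X), φ (σ • x) = σ • φ x

end SymmetricBezout

namespace SymmetricBezout

open MvPolynomial Matrix
open scoped LinearAlgebra.Projectivization

-- Homogeneous ideals in large degrees

attribute [local instance] MvPolynomial.gradedAlgebra

/-! Two ingredients determine the `S3`-set: its cardinality, and its points with nontrivial
stabilizer.

The cardinality is `d * e` by Bézout (`Transverse.finite_and_ncard_eq`). The ideal `(f, g)` has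
codimension `d * e` in large degrees, by a dimension count using coprimality. Evaluation at a finite
set `T` of points is surjective on forms of large degree, so its kernel has codimension `|T|`.
Transversality makes `(f, g)` and the forms vanishing on the intersection agree in large degrees, by
the Nullstellensatz applied to a colon ideal.

A nontrivially stabilized point is, up to the action, fixed by `(0 1)` or by the 3-cycle, so its
coordinate vector is an eigenvector with some eigenvalue `c`. Then the gradient of `f` is an
eigenvector with eigenvalue `c ^ (d - 1)`. Combined with Euler's identity and independence of the
gradients, this leaves only `[1 : -1 : 0]`, with `d * e` odd, and the orbit of `[1 : ω : ω²]`, with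
`d * e ≡ 2 mod 3`. Conversely, symmetry forces these points onto both curves when `d * e` is odd,
respectively prime to 3. Hence `d * e ≡ 1 mod 3` is impossible, and all other orbits are free and
are counted by Bézout. -/

theorem decompose_eq_homogeneousComponent {σ R : Type*} [CommSemiring R] (p : MvPolynomial σ R)
    (n : ℕ) :
    (DirectSum.decompose (homogeneousSubmodule σ R) p n : MvPolynomial σ R) =
      homogeneousComponent n p :=
  decomposition.decompose'_apply p n

theorem homogeneousComponent_mul_of_isHomogeneous {σ R : Type*} [CommSemiring R]
    {f : MvPolynomial σ R} {d : ℕ} (hf : f.IsHomogeneous d) (a : MvPolynomial σ R) (n : ℕ) :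
    homogeneousComponent (n + d) (a * f) = homogeneousComponent n a * f := by
  rw [← decompose_eq_homogeneousComponent, ← decompose_eq_homogeneousComponent,
    DirectSum.coe_decompose_mul_of_right_mem_of_le (homogeneousSubmodule σ R)
      (i := d) (n := n + d) hf (Nat.le_add_left _ _), Nat.add_sub_cancel]

theorem isHomogeneous_span_pair {σ R : Type*} [CommRing R] {f g : MvPolynomial σ R} {d e : ℕ}
    (hf : f.IsHomogeneous d) (hg : g.IsHomogeneous e) :
    (Ideal.span {f, g}).IsHomogeneous (homogeneousSubmodule σ R) := by
  refine Ideal.homogeneous_span _ _ ?_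
  rintro x (rfl | rfl)
  exacts [⟨d, hf⟩, ⟨e, hg⟩]

/-- If `m ^ N * J ≤ I` for the irrelevant ideal `m`, then `I` and `J` agree in large degrees. -/
theorem exists_forall_isHomogeneous_mem {σ R : Type*} [CommRing R]
    [IsNoetherianRing (MvPolynomial σ R)] {I J : Ideal (MvPolynomial σ R)} (hI : I.IsHomogeneous (homogeneousSubmodule σ R)) {N : ℕ}
    (hIJ : idealOfVars σ R ^ N * J ≤ I) :
    ∃ n₀, ∀ n ≥ n₀, ∀ h ∈ J, h.IsHomogeneous n → h ∈ I := by
  classical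
  obtain ⟨S, hS⟩ := (isNoetherianRing_iff_ideal_fg _).1 inferInstance J
  refine ⟨N + S.sup totalDegree + 1, fun n hn h hJ hh => ?_⟩
  rw [← hS] at hJ
  obtain ⟨a, -, rfl⟩ := Submodule.mem_span_finset.1 hJ
  rw [← homogeneousComponent_eq_self hh, map_sum]
  refine Ideal.sum_mem _ fun s hs => ?_
  -- Terms of the coefficient of degree below `N` contribute nothing in degree `n`, which is too
  -- large; the remaining terms lie in the `N`-th power of the irrelevant ideal.
  set low : MvPolynomial σ R := ∑ i ∈ Finset.range N, homogeneousComponent i (a s) with hlow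
  have hsplit : a s • s = low * s + (a s - low) * s := by simp only [smul_eq_mul]; ring
  have hdeg : (low * s).totalDegree < n := by
    have h1 : low.totalDegree ≤ N := by
      refine (totalDegree_finsetSum _ _).trans (Finset.sup_le fun i hi => ?_)
      exact (homogeneousComponent_isHomogeneous i (a s)).totalDegree_le.trans
        (Finset.mem_range.1 hi).le
    have h2 := totalDegree_mul low s
    have h3 : s.totalDegree ≤ S.sup totalDegree := Finset.le_sup hs
    omega
  rw [hsplit, map_add, homogeneousComponent_eq_zero _ _ hdeg, zero_add]
  refine homogeneousComponent_mem_of_mem hI (hIJ (Ideal.mul_mem_mul ?_ ?_)) n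
  · rw [mem_pow_idealOfVars_iff']
    intro x hx
    rw [coeff_sub, hlow, coeff_sum]
    simp only [coeff_homogeneousComponent]
    rw [Finset.sum_ite_eq, if_pos (Finset.mem_range.2 hx), sub_self]
  · rw [← hS]; exact Ideal.subset_span hs

theorem eval₂_smul_of_isHomogeneous {σ R A : Type*} [CommSemiring R] [CommSemiring A]
    (φ : R →+* A) {f : MvPolynomial σ R} {d : ℕ} (hf : f.IsHomogeneous d) (c : A) (x : σ → A) :
    eval₂ φ (c • x) f = c ^ d * eval₂ φ x f := by
  rw [eval₂_eq, eval₂_eq, Finset.mul_sum]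
  refine Finset.sum_congr rfl fun m hm => ?_
  simp only [Pi.smul_apply, smul_eq_mul, mul_pow, Finset.prod_mul_distrib,
    Finset.prod_pow_eq_pow_sum]
  rw [hf.degree_eq_sum_deg_support hm]
  ring

theorem eval_smul_of_isHomogeneous {σ R : Type*} [CommSemiring R]
    {f : MvPolynomial σ R} {d : ℕ} (hf : f.IsHomogeneous d) (c : R) (x : σ → R) :
    eval (c • x) f = c ^ d * eval x f :=
  eval₂_smul_of_isHomogeneous (RingHom.id R) hf c x

/-! ### Hilbert function of a complete intersection -/

theorem card_degree_eq (n : ℕ) :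
    Set.ncard {m : Fin 3 →₀ ℕ | m.degree = n} = (n + 2).choose 2 := by
  have : {m : Fin 3 →₀ ℕ | m.degree = n} =
      ((Finset.univ : Finset (Fin 3)).finsuppAntidiag n : Set (Fin 3 →₀ ℕ)) := by
    ext m
    simp [Finset.mem_finsuppAntidiag, Finsupp.degree_eq_sum]
  rw [this, Set.ncard_coe_finset, Finset.card_finsuppAntidiag_nat_eq_choose, Finset.card_univ,
    Fintype.card_fin, show 3 + n - 1 = n + 2 by omega, ← Nat.choose_symm (by omega)]
  simp

theorem finrank_homogeneousSubmodule {K : Type*} [Field K] (n : ℕ) :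
    Module.finrank K (homogeneousSubmodule (Fin 3) K n) = (n + 2).choose 2 := by
  rw [homogeneousSubmodule_eq_finsupp_supported, AddMonoidAlgebra.supported_eq_span_single,
    ← card_degree_eq n, Set.image_eq_range, ← Nat.card_coe_set_eq]
  -- An infinite type has `Nat.card` zero, so the positive count already gives finiteness.
  have hfin : Finite {m : Fin 3 →₀ ℕ | m.degree = n} :=
    Nat.finite_of_card_ne_zero (by
      rw [Nat.card_coe_set_eq, card_degree_eq]; exact (Nat.choose_pos (by omega)).ne')
  have := Fintype.ofFinite {m : Fin 3 →₀ ℕ | m.degree = n}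
  rw [Nat.card_eq_fintype_card]
  refine finrank_span_eq_card ?_
  have := (basisMonomials (Fin 3) K).linearIndependent
  rw [coe_basisMonomials] at this
  exact this.comp _ Subtype.val_injective

instance finiteDimensional_homogeneousSubmodule {σ K : Type*} [Finite σ] [Field K] (n : ℕ) :
    FiniteDimensional K (homogeneousSubmodule σ K n) :=
  Module.Finite.iff_fg.2 (homogeneousSubmodule_fg σ K n)

section HilbertFunction

variable {K : Type*} [Field K] {f g : MvPolynomial (Fin 3) K} {d e : ℕ}

theorem finrank_map_mulRight {p : MvPolynomial (Fin 3) K} (hp : p ≠ 0) (n : ℕ) :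
    Module.finrank K ((homogeneousSubmodule (Fin 3) K n).map (LinearMap.mulRight K p)) =
      (n + 2).choose 2 := by
  rw [← finrank_homogeneousSubmodule (K := K) n]
  refine (LinearEquiv.finrank_eq (Submodule.equivMapOfInjective _ ?_ _)).symm
  exact fun a b hab => mul_right_cancel₀ hp hab

/-- The part of degree `t + d + e` of the ideal spanned by forms of degrees `d` and `e`. -/
theorem span_pair_inf_homogeneousSubmodule (hf : f.IsHomogeneous d) (hg : g.IsHomogeneous e)
    (t : ℕ) :
    (Ideal.span {f, g}).restrictScalars K ⊓ homogeneousSubmodule (Fin 3) K (t + d + e) =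
      (homogeneousSubmodule (Fin 3) K (t + e)).map (LinearMap.mulRight K f) ⊔
        (homogeneousSubmodule (Fin 3) K (t + d)).map (LinearMap.mulRight K g) := by
  apply le_antisymm
  · rintro h ⟨hI, hh⟩
    obtain ⟨a, b, rfl⟩ := Ideal.mem_span_pair.1 hI
    rw [← homogeneousComponent_eq_self hh, map_add,
      homogeneousComponent_mul_of_isHomogeneous hg b,
      show t + d + e = t + e + d by omega, homogeneousComponent_mul_of_isHomogeneous hf a]
    exact Submodule.add_mem_sup ⟨_, homogeneousComponent_mem _ _, rfl⟩
      ⟨_, homogeneousComponent_mem _ _, rfl⟩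
  · refine sup_le ?_ ?_
    · rintro _ ⟨a, ha, rfl⟩
      refine ⟨Ideal.mul_mem_left _ _ (Ideal.subset_span (by simp)), ?_⟩
      have := IsHomogeneous.mul ha hf
      rwa [show t + e + d = t + d + e by omega] at this
    · rintro _ ⟨a, ha, rfl⟩
      exact ⟨Ideal.mul_mem_left _ _ (Ideal.subset_span (by simp)), IsHomogeneous.mul ha hg⟩

/-- Exactness of the Koszul complex: by coprimality the only syzygies of `f` and `g` are the trivial
ones. -/
theorem map_mulRight_inf_map_mulRight (hf : f.IsHomogeneous d) (hg : g.IsHomogeneous e)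
    (hfg : IsRelPrime f g) (t : ℕ) :
    (homogeneousSubmodule (Fin 3) K (t + e)).map (LinearMap.mulRight K f) ⊓
        (homogeneousSubmodule (Fin 3) K (t + d)).map (LinearMap.mulRight K g) =
      (homogeneousSubmodule (Fin 3) K t).map (LinearMap.mulRight K (f * g)) := by
  apply le_antisymm
  · rintro _ ⟨⟨a, ha, rfl⟩, ⟨b, hb, hab⟩⟩
    simp only [LinearMap.mulRight_apply] at hab ⊢
    obtain ⟨c, rfl⟩ : g ∣ a := hfg.symm.dvd_of_dvd_mul_right ⟨b, by rw [← hab, mul_comm]⟩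
    -- The quotient `c` is not known to be homogeneous, but its component of degree `t` has the same
    -- product with `g`.
    refine ⟨homogeneousComponent t c, homogeneousComponent_mem _ _, ?_⟩
    have h1 := homogeneousComponent_mul_of_isHomogeneous hg c t
    rw [mul_comm c g, homogeneousComponent_eq_self ha] at h1
    rw [LinearMap.mulRight_apply, h1]
    ring
  · rintro _ ⟨c, hc, rfl⟩
    refine ⟨⟨c * g, IsHomogeneous.mul hc hg, ?_⟩, ⟨c * f, IsHomogeneous.mul hc hf, ?_⟩⟩ <;>
      simp only [LinearMap.mulRight_apply] <;> ring

/-- The mixed second difference, with steps `d` and `e`, of a quadratic polynomial with leading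
coefficient `1/2`. -/
theorem choose_two_identity (t d e : ℕ) :
    (t + d + e + 2).choose 2 + (t + 2).choose 2 =
      (t + e + 2).choose 2 + (t + d + 2).choose 2 + d * e := by
  have key : ∀ n : ℕ, (((n + 2).choose 2 : ℕ) : ℚ) = (n + 2) * (n + 1) / 2 := by
    intro n
    rw [Nat.cast_choose_two]
    push_cast
    ring
  have : (((t + d + e + 2).choose 2 + (t + 2).choose 2 : ℕ) : ℚ) =
      ((t + e + 2).choose 2 + (t + d + 2).choose 2 + d * e : ℕ) := by
    push_cast [key]
    ring
  exact_mod_cast this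

/-- The Hilbert function of a complete intersection of two plane curves of degrees `d` and `e`
takes the value `d * e` in large degrees. -/
theorem finrank_span_pair_add (hf : f.IsHomogeneous d) (hg : g.IsHomogeneous e)
    (hf0 : f ≠ 0) (hg0 : g ≠ 0) (hfg : IsRelPrime f g) (t : ℕ) :
    Module.finrank K ↥((Ideal.span {f, g}).restrictScalars K ⊓
        homogeneousSubmodule (Fin 3) K (t + d + e)) + d * e =
      Module.finrank K (homogeneousSubmodule (Fin 3) K (t + d + e)) := by
  have h := Submodule.finrank_sup_add_finrank_inf_eq
    ((homogeneousSubmodule (Fin 3) K (t + e)).map (LinearMap.mulRight K f))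
    ((homogeneousSubmodule (Fin 3) K (t + d)).map (LinearMap.mulRight K g))
  rw [map_mulRight_inf_map_mulRight hf hg hfg, ← span_pair_inf_homogeneousSubmodule hf hg,
    finrank_map_mulRight hf0, finrank_map_mulRight hg0,
    finrank_map_mulRight (mul_ne_zero hf0 hg0)] at h
  have := choose_two_identity t d e
  rw [finrank_homogeneousSubmodule]
  omega

end HilbertFunction

/-! ### The intersection ideal near a transverse point -/

/-- The ideal of the line through `v`, spanned by the entries of `v ⨯₃ X`. -/
noncomputable def lineIdeal (v : Fin 3 → ℂ) : Ideal (MvPolynomial (Fin 3) ℂ) :=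
  Ideal.span (Set.range fun i => (crossProduct (fun j => C (v j)) X : Fin 3 → MvPolynomial (Fin 3) ℂ) i)

theorem mem_lineIdeal_iff {v : Fin 3 → ℂ} {f : MvPolynomial (Fin 3) ℂ} :
    f ∈ lineIdeal v ↔ ∃ A : Fin 3 → MvPolynomial (Fin 3) ℂ,
      A ⬝ᵥ crossProduct (fun j => C (v j)) X = f :=
  Ideal.mem_span_range_iff_exists_fun

theorem C_mul_X_sub_mem_lineIdeal (v : Fin 3 → ℂ) (i j : Fin 3) :
    C (v i) * X j - C (v j) * X i ∈ lineIdeal v := by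
  have h : ∀ k, (crossProduct (fun j => C (v j)) X : Fin 3 → MvPolynomial (Fin 3) ℂ) k ∈
      lineIdeal v := fun k => Ideal.subset_span ⟨k, rfl⟩
  have h12 : C (v 1) * X 2 - C (v 2) * X 1 ∈ lineIdeal v := by simpa [cross_apply] using h 0
  have h20 : C (v 2) * X 0 - C (v 0) * X 2 ∈ lineIdeal v := by simpa [cross_apply] using h 1
  have h01 : C (v 0) * X 1 - C (v 1) * X 0 ∈ lineIdeal v := by simpa [cross_apply] using h 2
  match i, j with
  | 0, 0 | 1, 1 | 2, 2 => simp
  | 0, 1 => exact h01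
  | 1, 2 => exact h12
  | 2, 0 => exact h20
  | 1, 0 => simpa using neg_mem h01
  | 2, 1 => simpa using neg_mem h12
  | 0, 2 => simpa using neg_mem h20

/-- Modulo the line ideal `v i • X = X i • v`, hence `v i ^ d * f(X) = X i ^ d * f(v) = 0`, and some
`v i` is invertible. -/
theorem mem_lineIdeal_of_isHomogeneous {v : Fin 3 → ℂ} (hv : v ≠ 0)
    {f : MvPolynomial (Fin 3) ℂ} {d : ℕ} (hf : f.IsHomogeneous d) (h : eval v f = 0) :
    f ∈ lineIdeal v := by
  obtain ⟨i, hi⟩ := Function.ne_iff.1 hv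
  set φ := Ideal.Quotient.mk (lineIdeal v) with hφ
  have h1 : φ (C (v i)) • (φ ∘ X) = φ (X i) • fun j => φ (C (v j)) := by
    ext j
    have := (Ideal.Quotient.eq (I := lineIdeal v)).2 (C_mul_X_sub_mem_lineIdeal v i j)
    simpa [mul_comm] using this
  have h2 : eval₂ (φ.comp C) (fun j => φ (C (v j))) f = φ (C (eval v f)) :=
    (eval₂_comp_left (φ.comp C) (RingHom.id ℂ) v f).symm
  have h3 : eval₂ (φ.comp C) (φ ∘ X) f = φ f := by
    rw [← eval₂_comp_left, eval₂_eta]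
  have h4 := eval₂_smul_of_isHomogeneous (φ.comp C) hf (φ (C (v i))) (φ ∘ X)
  rw [h1, eval₂_smul_of_isHomogeneous (φ.comp C) hf, h2, h3, h, map_zero, map_zero, mul_zero,
    ← map_pow, ← map_mul] at h4
  have h5 : C (v i ^ d) * f ∈ lineIdeal v := by
    rw [map_pow]
    exact Ideal.Quotient.eq_zero_iff_mem.1 h4.symm
  have := Ideal.mul_mem_left _ (C (v i ^ d)⁻¹) h5
  rwa [← mul_assoc, ← C_mul, inv_mul_cancel₀ (pow_ne_zero _ hi), C_1, one_mul] at this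

/-- Since `v × v = 0`, derivatives of `A` drop out of the product rule at `v`. -/
theorem gradVec_dotProduct_cross (v : Fin 3 → ℂ) (A : Fin 3 → MvPolynomial (Fin 3) ℂ) :
    gradVec (A ⬝ᵥ crossProduct (fun j => C (v j)) X) v =
      crossProduct (fun i => eval v (A i)) v := by
  ext i
  fin_cases i <;>
    simp [gradVec, dotProduct, Fin.sum_univ_three, cross_apply, pderiv_X] <;> ring

theorem cross_cross_cross (a b v : Fin 3 → ℂ) :
    crossProduct (crossProduct a v) (crossProduct b v) = (a ⬝ᵥ crossProduct b v) • v := by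
  ext i
  fin_cases i <;> simp [cross_apply, dotProduct, Fin.sum_univ_three] <;> ring

/-- Expansion of `w = c × x` in the reciprocal basis: `det(A,B,x) w = (A·w)(B×x) + (B·w)(x×A) +
(x·w)(A×B)`, whose last term vanishes. -/
theorem triple_mul_cross {R : Type*} [CommRing R] (A B c x : Fin 3 → R) (i : Fin 3) :
    ∃ a b : R, (A ⬝ᵥ crossProduct B x) * crossProduct c x i =
      a * (A ⬝ᵥ crossProduct c x) + b * (B ⬝ᵥ crossProduct c x) := by
  refine ⟨crossProduct B x i, crossProduct x A i, ?_⟩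
  fin_cases i <;> simp [cross_apply, dotProduct, Fin.sum_univ_three] <;> ring

/-- At a transverse intersection point `v`, the ideal of the line through `v` agrees with the
ideal of the intersection, locally at `v`. -/
theorem exists_mul_lineIdeal_le {f g : MvPolynomial (Fin 3) ℂ} {d e : ℕ}
    (hf : f.IsHomogeneous d) (hg : g.IsHomogeneous e) {v : Fin 3 → ℂ} (hv : v ≠ 0)
    (hfv : eval v f = 0) (hgv : eval v g = 0)
    (hfg : LinearIndependent ℂ ![gradVec f v, gradVec g v]) :
    ∃ s, eval v s ≠ 0 ∧ ∀ h ∈ lineIdeal v, s * h ∈ Ideal.span {f, g} := by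
  obtain ⟨A, rfl⟩ := mem_lineIdeal_iff.1 (mem_lineIdeal_of_isHomogeneous hv hf hfv)
  obtain ⟨B, rfl⟩ := mem_lineIdeal_iff.1 (mem_lineIdeal_of_isHomogeneous hv hg hgv)
  -- With `f = A·(v×X)` and `g = B·(v×X)`, the value of `det(A,B,X)` at `v` is the factor relating
  -- the cross product of the gradients to `v`, so transversality makes it nonzero.
  refine ⟨(A ⬝ᵥ crossProduct B X), fun h0 => ?_, fun h hh => ?_⟩
  · rw [gradVec_dotProduct_cross, gradVec_dotProduct_cross, ← crossProduct_ne_zero_iff_linearIndependent,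
      cross_cross_cross] at hfg
    apply hfg
    have : (fun i => eval v (A i)) ⬝ᵥ crossProduct (fun i => eval v (B i)) v =
        eval v ((A ⬝ᵥ crossProduct B X)) := by
      simp [cross_apply, dotProduct, Fin.sum_univ_three]
    rw [this, h0, zero_smul]
  · refine Submodule.span_induction (p := fun h _ => (A ⬝ᵥ crossProduct B X) * h ∈ Ideal.span _)
      ?_ ?_ ?_ ?_ hh
    · rintro _ ⟨i, rfl⟩
      obtain ⟨a, b, hab⟩ := triple_mul_cross A B (fun j => C (v j)) X i
      exact Ideal.mem_span_pair.2 ⟨a, b, hab.symm⟩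
    · simp
    · intro x y _ _ hx hy
      rw [mul_add]; exact add_mem hx hy
    · intro a x _ hx
      rw [smul_eq_mul, mul_left_comm]
      exact Ideal.mul_mem_left _ _ hx

theorem gradVec_mul_of_eval_eq_zero {h : MvPolynomial (Fin 3) ℂ} {v : Fin 3 → ℂ}
    (hv : eval v h = 0) (a : MvPolynomial (Fin 3) ℂ) :
    gradVec (h * a) v = eval v a • gradVec h v := by
  ext i
  simp [gradVec, Derivation.leibniz, hv]

/-- Nullstellensatz for an ideal with no zero away from the origin. -/
theorem idealOfVars_le_radical {I : Ideal (MvPolynomial (Fin 3) ℂ)}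
    (hI : ∀ v : Fin 3 → ℂ, v ≠ 0 → ∃ s ∈ I, eval v s ≠ 0) :
    idealOfVars (Fin 3) ℂ ≤ I.radical := by
  rw [← vanishingIdeal_zeroLocus_eq_radical (K := ℂ), Ideal.span_le]
  rintro _ ⟨i, rfl⟩ v hv
  rw [aeval_X]
  by_contra hvi
  obtain ⟨s, hs, hsv⟩ := hI v (fun h => hvi (by rw [h]; rfl))
  exact hsv (by simpa [coe_aeval_eq_eval] using hv s hs)

/-! ### Bézout's theorem for transverse curves -/

section Bezout

variable {f g : MvPolynomial (Fin 3) ℂ} {d e : ℕ}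

/-- At a zero of a common factor `h`, both gradients are multiples of that of `h`, hence dependent.
So `h` vanishes at most at the origin and divides powers of both `X 0` and `X 1`. -/
theorem Transverse.isRelPrime (hfg : Transverse f g) : IsRelPrime f g := by
  rintro h ⟨a, rfl⟩ ⟨b, rfl⟩
  have key : idealOfVars (Fin 3) ℂ ≤ (Ideal.span {h}).radical := by
    refine idealOfVars_le_radical fun v hv => ⟨h, Ideal.mem_span_singleton_self h, fun h0 => ?_⟩
    have hli := hfg v hv (by simp [h0]) (by simp [h0])
    rw [gradVec_mul_of_eval_eq_zero h0, gradVec_mul_of_eval_eq_zero h0] at hli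
    have h1 := LinearIndependent.pair_iff.1 hli (eval v b) (-eval v a) (by module)
    exact hli.ne_zero 0 (by simp [neg_eq_zero.1 h1.2])
  have hX : ∀ i : Fin 3, ∃ n : ℕ, h ∣ X i ^ n := fun i => by
    obtain ⟨n, hn⟩ := key (Ideal.subset_span ⟨i, rfl⟩)
    exact ⟨n, Ideal.mem_span_singleton.1 hn⟩
  obtain ⟨n, hn⟩ := hX 0
  obtain ⟨m, hm⟩ := hX 1
  have : IsRelPrime (X 0 : MvPolynomial (Fin 3) ℂ) (X 1) := by
    rw [X_prime.irreducible.isRelPrime_iff_not_dvd, X_dvd_X]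
    simp
  exact (this.pow (m := n) (n := m)) hn hm

/-- The colon ideal of `(f, g)` by the intersection of the line ideals has no zero off the origin:
at a common point `exists_mul_lineIdeal_le` supplies an element, elsewhere `f` or `g` serves. -/
theorem exists_pow_mul_iInf_lineIdeal_le (hf : f.IsHomogeneous d) (hg : g.IsHomogeneous e)
    (hfg : Transverse f g) :
    ∃ N, idealOfVars (Fin 3) ℂ ^ N *
      (⨅ v ∈ {v : Fin 3 → ℂ | v ≠ 0 ∧ eval v f = 0 ∧ eval v g = 0}, lineIdeal v) ≤
        Ideal.span {f, g} := by
  set J := ⨅ v ∈ {v : Fin 3 → ℂ | v ≠ 0 ∧ eval v f = 0 ∧ eval v g = 0}, lineIdeal v with hJ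
  let L : Ideal (MvPolynomial (Fin 3) ℂ) := (Ideal.span {f, g}).colon (J : Set _)
  have hmem : ∀ s, s ∈ L ↔ ∀ h ∈ J, s * h ∈ Ideal.span {f, g} := fun s => Submodule.mem_colon
  have hL : idealOfVars (Fin 3) ℂ ≤ L.radical := by
    refine idealOfVars_le_radical fun v hv => ?_
    by_cases hfv : eval v f = 0
    · by_cases hgv : eval v g = 0
      · obtain ⟨s, hs, hs'⟩ := exists_mul_lineIdeal_le hf hg hv hfv hgv (hfg v hv hfv hgv)
        refine ⟨s, (hmem s).2 fun h hh => hs' h ?_, hs⟩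
        rw [hJ] at hh
        simp only [Submodule.mem_iInf] at hh
        exact hh v ⟨hv, hfv, hgv⟩
      · exact ⟨g, (hmem g).2 fun h _ => Ideal.mul_mem_right _ _ (Ideal.subset_span (by simp)), hgv⟩
    · exact ⟨f, (hmem f).2 fun h _ => Ideal.mul_mem_right _ _ (Ideal.subset_span (by simp)), hfv⟩
  obtain ⟨N, hN⟩ := Ideal.exists_pow_le_of_le_radical_of_fg hL (idealOfVars_fg _ _)
  exact ⟨N, Ideal.mul_le.2 fun s hs h hh => (hmem s).1 (hN hs) h hh⟩

/-- In large degrees, a form vanishing on a transverse intersection lies in its ideal. -/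
theorem exists_forall_mem_span_pair (hf : f.IsHomogeneous d) (hg : g.IsHomogeneous e)
    (hfg : Transverse f g) :
    ∃ n₀, ∀ n ≥ n₀, ∀ h : MvPolynomial (Fin 3) ℂ, h.IsHomogeneous n →
      (∀ v, v ≠ 0 → eval v f = 0 → eval v g = 0 → eval v h = 0) → h ∈ Ideal.span {f, g} := by
  obtain ⟨N, hN⟩ := exists_pow_mul_iInf_lineIdeal_le hf hg hfg
  obtain ⟨n₀, hn₀⟩ := exists_forall_isHomogeneous_mem (isHomogeneous_span_pair hf hg) hN
  refine ⟨n₀, fun n hn h hh hv => hn₀ n hn h ?_ hh⟩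
  simp only [Submodule.mem_iInf]
  exact fun v hvm => mem_lineIdeal_of_isHomogeneous hvm.1 hh (hv v hvm.1 hvm.2.1 hvm.2.2)

/-- Evaluation at chosen homogeneous coordinates of the points of a finite set. -/
noncomputable def evalRep (T : Finset P2) (n : ℕ) :
    homogeneousSubmodule (Fin 3) ℂ n →ₗ[ℂ] (T → ℂ) :=
  (LinearMap.pi fun P : T => (aeval (R := ℂ) (Projectivization.rep P.1)).toLinearMap) ∘ₗ
    (homogeneousSubmodule (Fin 3) ℂ n).subtype

theorem evalRep_apply (T : Finset P2) (n : ℕ) (h : homogeneousSubmodule (Fin 3) ℂ n) (P : T) :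
    evalRep T n h P = eval (Projectivization.rep P.1) h.1 := by
  simp [evalRep]

theorem isHomogeneous_cross_X (v : Fin 3 → ℂ) (i : Fin 3) :
    ((crossProduct (fun j => C (v j)) X : Fin 3 → MvPolynomial (Fin 3) ℂ) i).IsHomogeneous 1 := by
  rw [cross_apply]
  fin_cases i <;> exact (isHomogeneous_C_mul_X _ _).sub (isHomogeneous_C_mul_X _ _)

theorem exists_linear_form_separating {P Q : P2} (hPQ : P ≠ Q) :
    ∃ l : MvPolynomial (Fin 3) ℂ, l.IsHomogeneous 1 ∧ eval P.rep l ≠ 0 ∧ eval Q.rep l = 0 := by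
  have h := Projectivization.independent_iff.1 ((Projectivization.independent_pair_iff_ne _ _).2 hPQ.symm)
  have h1 : LinearIndependent ℂ ![Q.rep, P.rep] := by
    have heq : Projectivization.rep ∘ ![Q, P] = ![Q.rep, P.rep] := by
      ext i : 1
      fin_cases i <;> rfl
    rwa [heq] at h
  rw [← crossProduct_ne_zero_iff_linearIndependent] at h1
  obtain ⟨i, hi⟩ := Function.ne_iff.1 h1
  have key : ∀ w : Fin 3 → ℂ, eval w ((crossProduct (fun j => C (Q.rep j)) X :
      Fin 3 → MvPolynomial (Fin 3) ℂ) i) = crossProduct Q.rep w i := by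
    intro w
    fin_cases i <;> simp [cross_apply]
  refine ⟨_, isHomogeneous_cross_X Q.rep i, ?_, ?_⟩
  · rw [key]; exact hi
  · rw [key, cross_self]; rfl

/-- A product of linear forms, each killing one other point of `T`, padded to degree `n` by powers
of a form nonzero at `P`. -/
theorem exists_form_interpolating (T : Finset P2) {n : ℕ} (hn : T.card ≤ n) (P : P2) :
    ∃ h : MvPolynomial (Fin 3) ℂ, h.IsHomogeneous n ∧ eval P.rep h ≠ 0 ∧
      ∀ Q ∈ T, Q ≠ P → eval Q.rep h = 0 := by
  classical
  have : ∀ Q, ∃ l : MvPolynomial (Fin 3) ℂ, l.IsHomogeneous 1 ∧ eval P.rep l ≠ 0 ∧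
      (Q ≠ P → eval Q.rep l = 0) := by
    intro Q
    by_cases hQ : Q = P
    · obtain ⟨i, hi⟩ := Function.ne_iff.1 P.rep_nonzero
      exact ⟨X i, isHomogeneous_X _ i, by simpa using hi, fun h => (h hQ).elim⟩
    · obtain ⟨l, h1, h2, h3⟩ := exists_linear_form_separating (Ne.symm hQ)
      exact ⟨l, h1, h2, fun _ => h3⟩
  choose l h1 h2 h3 using this
  refine ⟨(∏ Q ∈ T, l Q) * l P ^ (n - T.card), ?_, ?_, fun Q hQ hQP => ?_⟩
  · have := (IsHomogeneous.prod T l (fun _ => 1) fun Q _ => h1 Q).mul ((h1 P).pow (n - T.card))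
    simpa [Nat.add_sub_cancel' hn] using this
  · rw [map_mul, map_pow, map_prod]
    exact mul_ne_zero (Finset.prod_ne_zero_iff.2 fun Q _ => h2 Q) (pow_ne_zero _ (h2 P))
  · rw [map_mul, map_prod, Finset.prod_eq_zero hQ (h3 Q hQP), zero_mul]

theorem evalRep_surjective (T : Finset P2) {n : ℕ} (hn : T.card ≤ n) :
    Function.Surjective (evalRep T n) := by
  classical
  choose h h1 h2 h3 using exists_form_interpolating T hn
  intro y
  refine ⟨∑ P : T, (y P / eval P.1.rep (h P)) • ⟨h P, h1 P⟩, ?_⟩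
  ext Q
  rw [map_sum, Finset.sum_apply, Finset.sum_eq_single Q]
  · rw [map_smul, Pi.smul_apply, evalRep_apply, smul_eq_mul, div_mul_cancel₀ _ (h2 Q)]
  · intro P _ hPQ
    rw [map_smul, Pi.smul_apply, evalRep_apply, h3 P Q Q.2 (fun h => hPQ (Subtype.ext h.symm)),
      smul_zero]
  · simp

theorem card_add_finrank_ker_evalRep (T : Finset P2) {n : ℕ} (hn : T.card ≤ n) :
    T.card + Module.finrank ℂ (LinearMap.ker (evalRep T n)) =
      Module.finrank ℂ (homogeneousSubmodule (Fin 3) ℂ n) := by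
  rw [← LinearMap.finrank_range_add_finrank_ker (evalRep T n),
    LinearMap.range_eq_top.2 (evalRep_surjective T hn)]
  simp

theorem eval_rep_eq_zero_iff (hf : f.IsHomogeneous d) (P : P2) :
    eval P.rep f = 0 ↔ P ∈ zeroLocus f := by
  rw [← mk_mem_zeroLocus_iff hf P.rep P.rep_nonzero, Projectivization.mk_rep]

theorem eval_eq_zero_of_mem_span_pair {v : Fin 3 → ℂ} (hf : eval v f = 0) (hg : eval v g = 0)
    {h : MvPolynomial (Fin 3) ℂ} (hh : h ∈ Ideal.span {f, g}) : eval v h = 0 := by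
  obtain ⟨a, b, rfl⟩ := Ideal.mem_span_pair.1 hh
  simp [hf, hg]

theorem finrank_comap_subtype_span_pair (n : ℕ) :
    Module.finrank ℂ (((Ideal.span {f, g}).restrictScalars ℂ ⊓
      homogeneousSubmodule (Fin 3) ℂ n).comap (homogeneousSubmodule (Fin 3) ℂ n).subtype) =
    Module.finrank ℂ ↥((Ideal.span {f, g}).restrictScalars ℂ ⊓ homogeneousSubmodule (Fin 3) ℂ n) :=
  (Submodule.comapSubtypeEquivOfLe inf_le_right).finrank_eq

/-- In large degree `(f, g)` has codimension `d * e` and lies in the kernel of evaluation at `T`, of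
codimension `|T|`. Allowing any finite subset also yields finiteness of the intersection. -/
theorem card_le_of_subset_zeroLocus (hf : f.IsHomogeneous d) (hg : g.IsHomogeneous e)
    (hf0 : f ≠ 0) (hg0 : g ≠ 0) (hfg : IsRelPrime f g) {T : Finset P2}
    (hT : (T : Set P2) ⊆ zeroLocus f ∩ zeroLocus g) : T.card ≤ d * e := by
  have h1 := card_add_finrank_ker_evalRep T (n := T.card + d + e) (by omega)
  have h2 := finrank_span_pair_add hf hg hf0 hg0 hfg T.card
  have h3 := finrank_comap_subtype_span_pair (f := f) (g := g) (T.card + d + e)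
  have h4 : ((Ideal.span {f, g}).restrictScalars ℂ ⊓
      homogeneousSubmodule (Fin 3) ℂ (T.card + d + e)).comap
        (homogeneousSubmodule (Fin 3) ℂ (T.card + d + e)).subtype ≤
      LinearMap.ker (evalRep T (T.card + d + e)) := by
    rintro h ⟨hh, -⟩
    ext P
    rw [evalRep_apply]
    exact eval_eq_zero_of_mem_span_pair ((eval_rep_eq_zero_iff hf _).2 (hT P.2).1)
      ((eval_rep_eq_zero_iff hg _).2 (hT P.2).2) hh
  have h5 := Submodule.finrank_mono h4
  omega

/-- Bézout's theorem for transverse plane curves. -/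
theorem Transverse.finite_and_ncard_eq (hf : f.IsHomogeneous d) (hg : g.IsHomogeneous e)
    (hf0 : f ≠ 0) (hg0 : g ≠ 0) (hfg : Transverse f g) :
    (zeroLocus f ∩ zeroLocus g).Finite ∧ (zeroLocus f ∩ zeroLocus g).ncard = d * e := by
  have hfin : (zeroLocus f ∩ zeroLocus g).Finite := by
    by_contra hinf
    obtain ⟨T, hT, hcard⟩ := Set.Infinite.exists_subset_card_eq hinf (d * e + 1)
    have := card_le_of_subset_zeroLocus hf hg hf0 hg0 hfg.isRelPrime hT
    omega
  refine ⟨hfin, ?_⟩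
  obtain ⟨T, hT⟩ := hfin.exists_finset_coe
  rw [← hT, Set.ncard_coe_finset]
  obtain ⟨n₀, hn₀⟩ := exists_forall_mem_span_pair hf hg hfg
  set t := n₀ + T.card
  have h1 := card_add_finrank_ker_evalRep T (n := t + d + e) (by omega)
  have h2 := finrank_span_pair_add hf hg hf0 hg0 hfg.isRelPrime t
  have h3 := finrank_comap_subtype_span_pair (f := f) (g := g) (t + d + e)
  -- The inclusion opposite to the one behind the upper bound; it rests on transversality through
  -- `exists_forall_mem_span_pair`.
  have h4 : ((Ideal.span {f, g}).restrictScalars ℂ ⊓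
      homogeneousSubmodule (Fin 3) ℂ (t + d + e)).comap
        (homogeneousSubmodule (Fin 3) ℂ (t + d + e)).subtype ≥
      LinearMap.ker (evalRep T (t + d + e)) := by
    intro h hh
    refine ⟨hn₀ _ (by omega) h.1 h.2 fun v hv hfv hgv => ?_, h.2⟩
    have hmem : Projectivization.mk ℂ v hv ∈ T := by
      rw [← Finset.mem_coe, hT]
      exact ⟨(mk_mem_zeroLocus_iff hf v hv).2 hfv, (mk_mem_zeroLocus_iff hg v hv).2 hgv⟩
    have h0 := congrFun hh ⟨_, hmem⟩
    rw [evalRep_apply] at h0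
    exact (mk_mem_zeroLocus_iff h.2 v hv).1 ((eval_rep_eq_zero_iff h.2 _).1 h0)
  have h5 := Submodule.finrank_mono h4
  have h6 := card_le_of_subset_zeroLocus hf hg hf0 hg0 hfg.isRelPrime hT.subset
  omega

end Bezout

/-! ### Gradients of symmetric forms at eigenvectors of permutations -/

section SymmetricForms

variable {f g : MvPolynomial (Fin 3) ℂ} {d e : ℕ}

theorem eval_comp_of_isSymmetric (hf : f.IsSymmetric) (σ : S3) (v : Fin 3 → ℂ) :
    eval (v ∘ σ) f = eval v f := by
  rw [← eval_rename, hf σ]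

theorem gradVec_comp_of_isSymmetric (hf : f.IsSymmetric) (σ : S3) (v : Fin 3 → ℂ) :
    gradVec f (v ∘ σ) = gradVec f v ∘ σ := by
  ext i
  simp only [gradVec, Function.comp_apply]
  rw [← eval_rename, ← pderiv_rename σ.injective, hf σ]

theorem gradVec_smul_of_isHomogeneous (hf : f.IsHomogeneous d) (c : ℂ) (v : Fin 3 → ℂ) :
    gradVec f (c • v) = c ^ (d - 1) • gradVec f v := by
  ext i
  exact eval_smul_of_isHomogeneous hf.pderiv c v

/-- Differentiate the invariance of `f` and use that its partial derivatives have degree `d - 1`. -/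
theorem gradVec_comp_eq_smul (hf : f.IsSymmetric) (hfd : f.IsHomogeneous d) {σ : S3}
    {v : Fin 3 → ℂ} {c : ℂ} (h : v ∘ σ = c • v) :
    gradVec f v ∘ σ = c ^ (d - 1) • gradVec f v := by
  rw [← gradVec_comp_of_isSymmetric hf, h, gradVec_smul_of_isHomogeneous hfd]

theorem eval_eq_zero_of_comp_eq_smul (hf : f.IsSymmetric) (hfd : f.IsHomogeneous d) {σ : S3}
    {v : Fin 3 → ℂ} {c : ℂ} (h : v ∘ σ = c • v) (hc : c ^ d ≠ 1) : eval v f = 0 := by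
  have h1 := eval_comp_of_isSymmetric hf σ v
  rw [h, eval_smul_of_isHomogeneous hfd] at h1
  by_contra h0
  exact hc (mul_right_cancel₀ h0 (by rw [h1, one_mul]))

theorem sum_mul_gradVec_eq_zero (hf : f.IsHomogeneous d) {v : Fin 3 → ℂ} (hv : eval v f = 0) :
    v 0 * gradVec f v 0 + v 1 * gradVec f v 1 + v 2 * gradVec f v 2 = 0 := by
  have h := congrArg (eval v) hf.sum_X_mul_pderiv
  simpa [Fin.sum_univ_three, hv, gradVec] using h

/-- A transverse intersection of symmetric curves misses the axis of a transposition. -/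
theorem comp_swap_ne_self (hf : f.IsSymmetric) (hg : g.IsSymmetric) (hfd : f.IsHomogeneous d)
    (hge : g.IsHomogeneous e) {v : Fin 3 → ℂ} (hv : v ≠ 0) (hfv : eval v f = 0)
    (hgv : eval v g = 0) (hfg : LinearIndependent ℂ ![gradVec f v, gradVec g v]) :
    v ∘ Equiv.swap 0 1 ≠ v := by
  intro h
  have hv1 : v 1 = v 0 := congrFun h 0
  have hG : gradVec f v 1 = gradVec f v 0 := by
    have := gradVec_comp_of_isSymmetric hf (Equiv.swap 0 1) v
    rw [h] at this
    exact (congrFun this 0).symm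
  have hH : gradVec g v 1 = gradVec g v 0 := by
    have := gradVec_comp_of_isSymmetric hg (Equiv.swap 0 1) v
    rw [h] at this
    exact (congrFun this 0).symm
  have eG := sum_mul_gradVec_eq_zero hfd hfv
  have eH := sum_mul_gradVec_eq_zero hge hgv
  rw [hv1, hG] at eG
  rw [hv1, hH] at eH
  -- The two Euler relations form a linear system in `(2 * v 0, v 2)` with this determinant, and `v
  -- ≠ 0`. Up to sign it is the only nontrivial entry of the cross product of the gradients.
  have hD : gradVec f v 0 * gradVec g v 2 - gradVec f v 2 * gradVec g v 0 = 0 := by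
    by_contra hD
    have h0 : v 0 = 0 := by
      apply (mul_eq_zero.1 (?_ : v 0 * (2 * (gradVec f v 0 * gradVec g v 2 -
        gradVec f v 2 * gradVec g v 0)) = 0)).resolve_right (mul_ne_zero two_ne_zero hD)
      linear_combination gradVec g v 2 * eG - gradVec f v 2 * eH
    have h2 : v 2 = 0 := by
      apply (mul_eq_zero.1 (?_ : v 2 * (gradVec f v 0 * gradVec g v 2 -
        gradVec f v 2 * gradVec g v 0) = 0)).resolve_right hD
      linear_combination gradVec f v 0 * eH - gradVec g v 0 * eG
    apply hv
    ext i
    fin_cases i <;> simp [h0, h2, hv1]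
  rw [← crossProduct_ne_zero_iff_linearIndependent] at hfg
  apply hfg
  rw [cross_apply, hG, hH]
  ext i
  fin_cases i
  · simpa using hD
  · simp only [Fin.mk_one, cons_val_one, cons_val_zero, Pi.zero_apply]
    linear_combination -hD
  · simp only [Fin.reduceFinMk, cons_val, Pi.zero_apply]
    ring

/-- Here `v = (v 0, -v 0, 0)`. For even `d` the gradient has the same shape, and Euler's identity
then kills it. -/
theorem odd_of_comp_swap_eq_neg (hf : f.IsSymmetric) (hd : 1 ≤ d) (hfd : f.IsHomogeneous d)
    {v : Fin 3 → ℂ} (h : v ∘ Equiv.swap 0 1 = (-1 : ℂ) • v) (hv0 : v 0 ≠ 0) (hfv : eval v f = 0)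
    (hG : gradVec f v ≠ 0) : Odd d := by
  by_contra hodd
  rw [Nat.not_odd_iff_even] at hodd
  have hk := gradVec_comp_eq_smul hf hfd h
  rw [Odd.neg_one_pow (Nat.Even.sub_odd hd hodd odd_one)] at hk
  have hv1 : v 1 = -v 0 := by simpa using congrFun h 0
  have hv2 : v 2 = 0 := by
    have : v 2 = -v 2 := by simpa [Equiv.swap_apply_of_ne_of_ne] using congrFun h 2
    exact self_eq_neg.1 this
  have hG1 : gradVec f v 1 = -gradVec f v 0 := by simpa using congrFun hk 0
  have hG2 : gradVec f v 2 = 0 := by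
    have : gradVec f v 2 = -gradVec f v 2 := by
      simpa [Equiv.swap_apply_of_ne_of_ne] using congrFun hk 2
    exact self_eq_neg.1 this
  have eG := sum_mul_gradVec_eq_zero hfd hfv
  rw [hv1, hv2, hG1] at eG
  have hG0 : gradVec f v 0 = 0 := by
    apply (mul_eq_zero.1 (?_ : v 0 * (2 * gradVec f v 0) = 0)).resolve_left hv0 |> fun h =>
      (mul_eq_zero.1 h).resolve_left two_ne_zero
    linear_combination eG
  apply hG
  ext i
  fin_cases i <;> simp [hG0, hG1, hG2]

theorem cyclic_coordinates {R : Type*} [CommRing R] {v : Fin 3 → R} {c : R}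
    (h : v ∘ ⇑(finRotate 3)⁻¹ = c • v) : v 1 = c ^ 2 * v 0 ∧ v 2 = c * v 0 := by
  have h0 : v 2 = c * v 0 := congrFun h 0
  have h2 : v 1 = c * v 2 := congrFun h 2
  exact ⟨by rw [h2, h0]; ring, h0⟩

/-- Euler's identity for `v ∝ (1, c², c)` and gradient `∝ (1, q², q)`, where `q = c ^ (d - 1)`. -/
theorem one_add_pow_add_sq_eq_zero (hf : f.IsSymmetric) (hd : 1 ≤ d) (hfd : f.IsHomogeneous d)
    {v : Fin 3 → ℂ} {c : ℂ} (h : v ∘ ⇑(finRotate 3)⁻¹ = c • v) (hv0 : v 0 ≠ 0)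
    (hfv : eval v f = 0) (hG : gradVec f v ≠ 0) : 1 + c ^ d + (c ^ d) ^ 2 = 0 := by
  obtain ⟨hv1, hv2⟩ := cyclic_coordinates h
  obtain ⟨hG1, hG2⟩ := cyclic_coordinates (gradVec_comp_eq_smul hf hfd h)
  have hG0 : gradVec f v 0 ≠ 0 := by
    intro h0
    apply hG
    ext i
    fin_cases i <;> simp [h0, hG1, hG2]
  have eG := sum_mul_gradVec_eq_zero hfd hfv
  rw [hv1, hv2, hG1, hG2] at eG
  obtain ⟨m, rfl⟩ := Nat.exists_eq_add_of_le' hd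
  rw [Nat.add_sub_cancel] at eG
  apply (mul_eq_zero.1 (?_ : v 0 * gradVec f v 0 * _ = 0)).resolve_left (mul_ne_zero hv0 hG0)
  linear_combination eG

/-- Eigenspaces of the 3-cycle are lines, so equal eigenvalues would make the gradients
proportional. -/
theorem pow_sub_one_ne_of_linearIndependent (hf : f.IsSymmetric) (hg : g.IsSymmetric)
    (hfd : f.IsHomogeneous d) (hge : g.IsHomogeneous e) {v : Fin 3 → ℂ} {c : ℂ}
    (h : v ∘ ⇑(finRotate 3)⁻¹ = c • v)
    (hfg : LinearIndependent ℂ ![gradVec f v, gradVec g v]) : c ^ (d - 1) ≠ c ^ (e - 1) := by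
  intro hde
  obtain ⟨hG1, hG2⟩ := cyclic_coordinates (gradVec_comp_eq_smul hf hfd h)
  obtain ⟨hH1, hH2⟩ := cyclic_coordinates (gradVec_comp_eq_smul hg hge h)
  rw [← crossProduct_ne_zero_iff_linearIndependent] at hfg
  apply hfg
  rw [cross_apply, hG1, hG2, hH1, hH2, hde]
  ext i
  fin_cases i <;> simp <;> ring

end SymmetricForms

/-! ### The two special points and their stabilizers -/

theorem smul_mk (σ : S3) (v : Fin 3 → ℂ) (hv : v ≠ 0) :
    σ • (Projectivization.mk ℂ v hv : P2) =
      Projectivization.mk ℂ (permCoords σ v) ((permCoords_injective σ).ne_iff' (map_zero _) |>.2 hv) :=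
  rfl

theorem smul_mk_eq_mk_iff (σ : S3) (v w : Fin 3 → ℂ) (hv : v ≠ 0) (hw : w ≠ 0) :
    σ • (Projectivization.mk ℂ v hv : P2) = Projectivization.mk ℂ w hw ↔
      ∃ c : ℂ, v ∘ ⇑σ⁻¹ = c • w := by
  rw [smul_mk, Projectivization.mk_eq_mk_iff']
  exact exists_congr fun c => eq_comm

/-- The point `[1 : -1 : 0]`. -/
noncomputable def antiPoint : P2 :=
  Projectivization.mk ℂ ![1, -1, 0] (fun h => one_ne_zero (congrFun h 0))

/-- The point `[1 : ω : ω²]`. -/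
noncomputable def cyclicPoint (ω : ℂ) : P2 :=
  Projectivization.mk ℂ ![1, ω, ω ^ 2] (fun h => one_ne_zero (congrFun h 0))

theorem comp_swap_antiPoint :
    (![1, -1, 0] : Fin 3 → ℂ) ∘ ⇑(Equiv.swap 0 1 : S3) = (-1 : ℂ) • ![1, -1, 0] := by
  ext i
  fin_cases i <;> simp [Equiv.swap_apply_of_ne_of_ne]

theorem comp_finRotate_cyclicPoint {ω : ℂ} (hω : ω ^ 3 = 1) :
    (![1, ω, ω ^ 2] : Fin 3 → ℂ) ∘ ⇑(finRotate 3)⁻¹ = (ω ^ 2) • ![1, ω, ω ^ 2] := by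
  ext i
  fin_cases i
  · change ω ^ 2 = ω ^ 2 * 1
    ring
  · change 1 = ω ^ 2 * ω
    rw [← hω]; ring
  · change ω = ω ^ 2 * ω ^ 2
    linear_combination -ω * hω

theorem swap_smul_antiPoint : (Equiv.swap 0 1 : S3) • antiPoint = antiPoint :=
  (smul_mk_eq_mk_iff _ _ _ _ _).2 ⟨-1, comp_swap_antiPoint⟩

theorem finRotate_smul_cyclicPoint {ω : ℂ} (hω : ω ^ 3 = 1) :
    (finRotate 3 : S3) • cyclicPoint ω = cyclicPoint ω :=
  (smul_mk_eq_mk_iff _ _ _ _ _).2 ⟨ω ^ 2, comp_finRotate_cyclicPoint hω⟩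

theorem stabilizer_antiPoint : MulAction.stabilizer S3 antiPoint = C2 := by
  apply le_antisymm
  · intro σ hσ
    obtain ⟨c, hc⟩ := (smul_mk_eq_mk_iff _ _ _ _ _).1 (MulAction.mem_stabilizer_iff.1 hσ)
    have h2 : (![1, -1, 0] : Fin 3 → ℂ) (σ⁻¹ 2) = c * 0 := congrFun hc 2
    have key : ∀ σ : S3, σ = 1 ∨ σ = Equiv.swap 0 1 ∨ σ⁻¹ 2 = 0 ∨ σ⁻¹ 2 = 1 := by decide
    rcases key σ with rfl | rfl | h | h
    · exact one_mem _
    · exact Subgroup.mem_zpowers _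
    · rw [h] at h2; simp at h2
    · rw [h] at h2; simp at h2
  · exact (Subgroup.zpowers_le).2 swap_smul_antiPoint

theorem stabilizer_cyclicPoint {ω : ℂ} (hω : IsPrimitiveRoot ω 3) :
    MulAction.stabilizer S3 (cyclicPoint ω) = C3 := by
  have h0 : ω ≠ 0 := hω.ne_zero (by norm_num)
  have h1 : ω ≠ 1 := hω.ne_one (by norm_num)
  apply le_antisymm
  · intro σ hσ
    obtain ⟨c, hc⟩ := (smul_mk_eq_mk_iff _ _ _ _ _).1 (MulAction.mem_stabilizer_iff.1 hσ)
    set w : Fin 3 → ℂ := ![1, ω, ω ^ 2] with hw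
    have hw0 : ∀ k, w k ≠ 0 := by
      intro k
      fin_cases k <;> simp [hw, h0]
    have hinj : ∀ i j, i ≠ j → w i ≠ w j := by
      have h12 : ω ≠ ω ^ 2 := fun h => h1 (mul_left_cancel₀ h0 (by linear_combination -h))
      have h02 : (1 : ℂ) ≠ ω ^ 2 := fun h => hω.pow_ne_one_of_pos_of_lt two_ne_zero (by norm_num) h.symm
      intro i j hij
      fin_cases i <;> fin_cases j <;> first
        | exact (hij rfl).elim
        | simpa [hw] using h12
        | simpa [hw] using h12.symm
        | simpa [hw] using h02
        | simpa [hw] using h02.symm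
        | simpa [hw] using h1
        | simpa [hw] using h1.symm
    -- A transposition fixes an index, where the nonzero coordinate forces scale factor `1`; but it
    -- also moves an index, and the coordinates are distinct.
    have key : ∀ σ : S3, σ = 1 ∨ σ = finRotate 3 ∨ σ = finRotate 3 ^ 2 ∨
        ∃ k i j, i ≠ j ∧ σ⁻¹ k = k ∧ σ⁻¹ i = j := by decide
    rcases key σ with rfl | rfl | rfl | ⟨k, i, j, hij, hk, hi⟩
    · exact one_mem _
    · exact Subgroup.mem_zpowers _
    · exact pow_mem (Subgroup.mem_zpowers _) 2
    · have hck : w (σ⁻¹ k) = c * w k := congrFun hc k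
      have hci : w (σ⁻¹ i) = c * w i := congrFun hc i
      rw [hk] at hck
      have hc1 : c = 1 := mul_right_cancel₀ (hw0 k) (by rw [← hck, one_mul])
      rw [hi, hc1, one_mul] at hci
      exact (hinj i j hij hci.symm).elim
  · exact (Subgroup.zpowers_le).2 (finRotate_smul_cyclicPoint hω.pow_eq_one)

/-! ### Fixed points on a transverse intersection -/

section FixedPoints

variable {f g : MvPolynomial (Fin 3) ℂ} {d e : ℕ}

theorem antiPoint_mem_zeroLocus (hf : f.IsSymmetric) (hfd : f.IsHomogeneous d) (hd : Odd d) :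
    antiPoint ∈ zeroLocus f :=
  (mk_mem_zeroLocus_iff hfd _ _).2 (eval_eq_zero_of_comp_eq_smul hf hfd comp_swap_antiPoint
    (by rw [hd.neg_one_pow]; norm_num))

theorem cyclicPoint_mem_zeroLocus {ω : ℂ} (hω : IsPrimitiveRoot ω 3) (hf : f.IsSymmetric)
    (hfd : f.IsHomogeneous d) (hd : ¬ 3 ∣ d) : cyclicPoint ω ∈ zeroLocus f := by
  refine (mk_mem_zeroLocus_iff hfd _ _).2 (eval_eq_zero_of_comp_eq_smul hf hfd
    (comp_finRotate_cyclicPoint hω.pow_eq_one) fun h => hd ?_)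
  rw [← pow_mul] at h
  exact (Nat.Coprime.dvd_mul_left (by norm_num)).1 (hω.dvd_of_pow_eq_one _ h)

/-- Eigenvalue `1` is excluded by `comp_swap_ne_self`; eigenvalue `-1` leaves one point, where
smoothness of each curve makes its degree odd. -/
theorem eq_antiPoint_of_swap_smul (hd : 1 ≤ d) (he : 1 ≤ e) (hfd : f.IsHomogeneous d)
    (hge : g.IsHomogeneous e) (hf : f.IsSymmetric) (hg : g.IsSymmetric) (hfg : Transverse f g)
    {x : P2} (hxf : x ∈ zeroLocus f) (hxg : x ∈ zeroLocus g)
    (hx : (Equiv.swap 0 1 : S3) • x = x) : x = antiPoint ∧ Odd (d * e) := by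
  induction x using Projectivization.ind with
  | h v hv =>
    rw [mk_mem_zeroLocus_iff hfd] at hxf
    rw [mk_mem_zeroLocus_iff hge] at hxg
    have hli := hfg v hv hxf hxg
    obtain ⟨c, hc⟩ := (smul_mk_eq_mk_iff _ _ _ _ _).1 hx
    rw [Equiv.swap_inv] at hc
    have h0 : v 1 = c * v 0 := congrFun hc 0
    have h1 : v 0 = c * v 1 := congrFun hc 1
    have h2 : v 2 = c * v 2 := congrFun hc 2
    have hc1 : c ≠ 1 := by
      rintro rfl
      exact comp_swap_ne_self hf hg hfd hge hv hxf hxg hli (by rw [hc, one_smul])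
    have hv2 : v 2 = 0 := by
      apply (mul_eq_zero.1 (?_ : (c - 1) * v 2 = 0)).resolve_left (sub_ne_zero.2 hc1)
      linear_combination -h2
    have hv0 : v 0 ≠ 0 := by
      intro h
      apply hv
      ext i
      fin_cases i <;> simp [h, h0, hv2]
    have hcc : c = -1 := by
      have : (c - 1) * (c + 1) = 0 := by
        apply mul_right_cancel₀ hv0
        rw [h0] at h1
        linear_combination -h1
      exact eq_neg_of_add_eq_zero_left ((mul_eq_zero.1 this).resolve_left (sub_ne_zero.2 hc1))
    subst hcc
    refine ⟨?_, Nat.odd_mul.2 ⟨odd_of_comp_swap_eq_neg hf hd hfd hc hv0 hxf (hli.ne_zero 0),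
      odd_of_comp_swap_eq_neg hg he hge hc hv0 hxg (hli.ne_zero 1)⟩⟩
    refine (Projectivization.mk_eq_mk_iff' _ _ _ _ _).2 ⟨v 0, ?_⟩
    ext i
    fin_cases i <;> simp [h0, hv2]

/-- The eigenvalue is a cube root of unity, and `1` would give `[1 : 1 : 1]`, which lies on the axis
of a transposition. Smoothness excludes `3 ∣ d` and `3 ∣ e`, independence of the gradients excludes
`d ≡ e mod 3`, so the residues are `1` and `2`. -/
theorem mem_orbit_cyclicPoint_of_finRotate_smul {ω : ℂ} (hω : IsPrimitiveRoot ω 3) (hd : 1 ≤ d)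
    (he : 1 ≤ e) (hfd : f.IsHomogeneous d) (hge : g.IsHomogeneous e) (hf : f.IsSymmetric)
    (hg : g.IsSymmetric) (hfg : Transverse f g) {x : P2} (hxf : x ∈ zeroLocus f)
    (hxg : x ∈ zeroLocus g) (hx : (finRotate 3 : S3) • x = x) :
    x ∈ MulAction.orbit S3 (cyclicPoint ω) ∧ d * e % 3 = 2 := by
  induction x using Projectivization.ind with
  | h v hv =>
    rw [mk_mem_zeroLocus_iff hfd] at hxf
    rw [mk_mem_zeroLocus_iff hge] at hxg
    have hli := hfg v hv hxf hxg
    obtain ⟨c, hc⟩ := (smul_mk_eq_mk_iff _ _ _ _ _).1 hx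
    obtain ⟨hv1, hv2⟩ := cyclic_coordinates hc
    have h1 : v 0 = c * v 1 := congrFun hc 1
    have hv0 : v 0 ≠ 0 := by
      intro h
      apply hv
      ext i
      fin_cases i <;> simp [h, hv1, hv2]
    have hc1 : c ≠ 1 := by
      rintro rfl
      refine comp_swap_ne_self hf hg hfd hge hv hxf hxg hli ?_
      ext i
      fin_cases i <;> simp [hv1, Equiv.swap_apply_of_ne_of_ne]
    have hc3 : c ^ 3 = 1 := by
      apply mul_right_cancel₀ hv0
      linear_combination -h1 - c * hv1
    have hsq : ∀ n : ℕ, 1 + c ^ n + (c ^ n) ^ 2 = 0 → ¬ 3 ∣ n := by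
      rintro n hn ⟨m, rfl⟩
      rw [pow_mul, hc3] at hn
      norm_num at hn
    have hd3 := hsq d (one_add_pow_add_sq_eq_zero hf hd hfd hc hv0 hxf (hli.ne_zero 0))
    have he3 := hsq e (one_add_pow_add_sq_eq_zero hg he hge hc hv0 hxg (hli.ne_zero 1))
    have hde := pow_sub_one_ne_of_linearIndependent hf hg hfd hge hc hli
    have hde3 : d % 3 ≠ e % 3 := by
      intro h
      apply hde
      rw [← Nat.mod_add_div (d - 1) 3, ← Nat.mod_add_div (e - 1) 3, pow_add, pow_add, pow_mul,
        pow_mul, hc3, one_pow, one_pow, show (d - 1) % 3 = (e - 1) % 3 by omega]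
    refine ⟨?_, ?_⟩
    · obtain ⟨i, hi, rfl⟩ := hω.eq_pow_of_pow_eq_one hc3
      -- Eigenvalue `ω` gives `[1 : ω² : ω]`, the cyclic point with its last two coordinates
      -- exchanged; `ω²` gives the cyclic point itself.
      interval_cases i
      · simp at hc1
      · refine ⟨Equiv.swap 1 2, (smul_mk_eq_mk_iff _ _ _ _ _).2 ⟨(v 0)⁻¹, ?_⟩⟩
        ext i
        fin_cases i
        · change 1 = (v 0)⁻¹ * v 0
          rw [inv_mul_cancel₀ hv0]
        · change ω ^ 2 = (v 0)⁻¹ * v 1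
          rw [hv1]; field_simp
        · change ω = (v 0)⁻¹ * v 2
          rw [hv2]; field_simp
      · refine ⟨1, (smul_mk_eq_mk_iff _ _ _ _ _).2 ⟨(v 0)⁻¹, ?_⟩⟩
        ext i
        fin_cases i
        · change 1 = (v 0)⁻¹ * v 0
          rw [inv_mul_cancel₀ hv0]
        · change ω = (v 0)⁻¹ * v 1
          rw [hv1]; field_simp; linear_combination -ω * hω.pow_eq_one
        · change ω ^ 2 = (v 0)⁻¹ * v 2
          rw [hv2]; field_simp
    · have h3 : d % 3 = 1 ∧ e % 3 = 2 ∨ d % 3 = 2 ∧ e % 3 = 1 := by omega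
      rcases h3 with ⟨h, h'⟩ | ⟨h, h'⟩ <;> simp [Nat.mul_mod, h, h']

end FixedPoints

/-! ### Decomposition of finite `S3`-sets into orbits -/

section OrbitDecomposition

/-- The map `G ⧸ H → X` sending the coset of `g` to `g • x`, for `H` fixing `x`. -/
def cosetMap {G X : Type*} [Group G] [MulAction G X] {H : Subgroup G} (x : X)
    (h : MulAction.stabilizer G x = H) (c : G ⧸ H) : X :=
  MulAction.ofQuotientStabilizer G x (Subgroup.quotientEquivOfEq h.symm c)

variable {G X : Type*} [Group G] [MulAction G X] {H : Subgroup G}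

theorem cosetMap_smul (x : X) (h : MulAction.stabilizer G x = H) (g : G) (c : G ⧸ H) :
    cosetMap x h (g • c) = g • cosetMap x h c := by
  induction c using QuotientGroup.induction_on with
  | H τ => exact mul_smul g τ x

theorem cosetMap_injective (x : X) (h : MulAction.stabilizer G x = H) :
    Function.Injective (cosetMap x h) :=
  (MulAction.injective_ofQuotientStabilizer G x).comp (Equiv.injective _)

theorem cosetMap_mem_orbit (x : X) (h : MulAction.stabilizer G x = H) (c : G ⧸ H) :
    cosetMap x h c ∈ MulAction.orbit G x :=
  MulAction.ofQuotientStabilizer_mem_orbit G x _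

theorem card_stabilizer_eq_of_mem_orbit {x y : X} (h : x ∈ MulAction.orbit G y) :
    Nat.card (MulAction.stabilizer G x) = Nat.card (MulAction.stabilizer G y) := by
  obtain ⟨g, rfl⟩ := h
  dsimp only
  rw [MulAction.stabilizer_smul_eq_stabilizer_map_conj]
  exact (Nat.card_congr ((MulAction.stabilizer G y).equivMapOfInjective _
    (MulAut.conj g).injective).toEquiv).symm

end OrbitDecomposition

theorem card_C2 : Nat.card C2 = 2 := by
  rw [C2, Nat.card_zpowers]
  exact orderOf_eq_prime (by decide) (by decide)

theorem card_C3 : Nat.card C3 = 3 := by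
  rw [C3, Nat.card_zpowers]
  exact orderOf_eq_prime (by decide) (by decide)

theorem card_S3 : Nat.card S3 = 6 := by
  rw [Nat.card_eq_fintype_card, Fintype.card_perm, Fintype.card_fin]
  rfl

theorem card_quotient_C2 : Nat.card (S3 ⧸ C2) = 3 := by
  have := Subgroup.card_eq_card_quotient_mul_card_subgroup C2
  rw [card_S3, card_C2] at this
  omega

theorem card_quotient_C3 : Nat.card (S3 ⧸ C3) = 2 := by
  have := Subgroup.card_eq_card_quotient_mul_card_subgroup C3
  rw [card_S3, card_C3] at this
  omega

theorem card_orbitSum (k a b : ℕ) : Nat.card (OrbitSum k a b) = 6 * k + 3 * a + 2 * b := by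
  rw [Nat.card_sum, Nat.card_sum, Nat.card_sigma, Nat.card_sigma, Nat.card_sigma]
  simp only [card_S3, card_quotient_C2, card_quotient_C3, Finset.sum_const, Finset.card_univ,
    Fintype.card_fin, smul_eq_mul]
  ring

/-- A finite `S3`-set in which, apart from at most one orbit of each of the types `S3 ⧸ C2` and
`S3 ⧸ C3`, all orbits are free, is determined by its cardinality. -/
theorem isomorphic_orbitSum {X : Type} [MulAction S3 X] [Finite X] {k a b : ℕ}
    (hcard : Nat.card X = 6 * k + 3 * a + 2 * b) (ha : a ≤ 1) (hb : b ≤ 1)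
    (p : Fin a → X) (hp : ∀ i, MulAction.stabilizer S3 (p i) = C2)
    (q : Fin b → X) (hq : ∀ i, MulAction.stabilizer S3 (q i) = C3)
    (hcover : ∀ x : X, MulAction.stabilizer S3 x = ⊥ ∨ (∃ i, x ∈ MulAction.orbit S3 (p i)) ∨
      ∃ i, x ∈ MulAction.orbit S3 (q i)) :
    Isomorphic X (OrbitSum k a b) := by
  classical
  -- `Ω` indexes the free orbits; their number is only identified with `k` at the end, by counting.
  let Ω := {ω : MulAction.orbitRel.Quotient S3 X // MulAction.stabilizer S3 ω.out = ⊥}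
  have : Finite (MulAction.orbitRel.Quotient S3 X) := Quotient.finite _
  have : Fintype Ω := Fintype.ofFinite Ω
  let r : Fin (Fintype.card Ω) → X := fun i => ((Fintype.equivFin Ω).symm i).1.out
  have hr : ∀ i, MulAction.stabilizer S3 (r i) = ⊥ := fun i => ((Fintype.equivFin Ω).symm i).2
  have hr_inj : ∀ i j, r i ∈ MulAction.orbit S3 (r j) → i = j := by
    intro i j h
    have h1 : (⟦r i⟧ : MulAction.orbitRel.Quotient S3 X) = ⟦r j⟧ := Quotient.sound h
    simp only [r, Quotient.out_eq] at h1
    exact (Fintype.equivFin Ω).symm.injective (Subtype.ext h1)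
  have hr_cover : ∀ x : X, MulAction.stabilizer S3 x = ⊥ → ∃ i, x ∈ MulAction.orbit S3 (r i) := by
    intro x hx
    have hmem : (⟦x⟧ : MulAction.orbitRel.Quotient S3 X).out ∈ MulAction.orbit S3 x :=
      Quotient.mk_out (s := MulAction.orbitRel S3 X) x
    have hst : MulAction.stabilizer S3 (⟦x⟧ : MulAction.orbitRel.Quotient S3 X).out = ⊥ := by
      rw [Subgroup.eq_bot_iff_card, card_stabilizer_eq_of_mem_orbit hmem, hx, Subgroup.card_bot]
    refine ⟨Fintype.equivFin Ω ⟨⟦x⟧, hst⟩, ?_⟩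
    simp only [r, Equiv.symm_apply_apply]
    exact MulAction.mem_orbit_symm.1 hmem
  let ψ : OrbitSum (Fintype.card Ω) a b → X :=
    Sum.elim (fun y => y.2 • r y.1)
      (Sum.elim (fun y => cosetMap (p y.1) (hp y.1) y.2) (fun y => cosetMap (q y.1) (hq y.1) y.2))
  have hψ : ∀ (σ : S3) y, ψ (σ • y) = σ • ψ y := by
    rintro σ (⟨i, τ⟩ | ⟨i, c⟩ | ⟨i, c⟩)
    · exact mul_smul σ τ (r i)
    · exact cosetMap_smul (p i) (hp i) σ c
    · exact cosetMap_smul (q i) (hq i) σ c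
  -- Stabilizer orders 1, 2 and 3 keep the three kinds of orbit apart.
  have hsep : ∀ {x y z : X}, z ∈ MulAction.orbit S3 x → z ∈ MulAction.orbit S3 y →
      Nat.card (MulAction.stabilizer S3 x) = Nat.card (MulAction.stabilizer S3 y) := by
    intro x y z hx hy
    rw [← card_stabilizer_eq_of_mem_orbit hx, card_stabilizer_eq_of_mem_orbit hy]
  have hcr : ∀ i, Nat.card (MulAction.stabilizer S3 (r i)) = 1 := fun i => by
    rw [hr, Subgroup.card_bot]
  have hcp : ∀ i, Nat.card (MulAction.stabilizer S3 (p i)) = 2 := fun i => by rw [hp, card_C2]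
  have hcq : ∀ i, Nat.card (MulAction.stabilizer S3 (q i)) = 3 := fun i => by rw [hq, card_C3]
  have hinj : Function.Injective ψ := by
    have hrp : ∀ i τ j c, τ • r i ≠ cosetMap (p j) (hp j) c := fun i τ j c h => by
      have := hsep (MulAction.mem_orbit (r i) τ) (h ▸ cosetMap_mem_orbit (p j) (hp j) c)
      rw [hcr, hcp] at this
      omega
    have hrq : ∀ i τ j c, τ • r i ≠ cosetMap (q j) (hq j) c := fun i τ j c h => by
      have := hsep (MulAction.mem_orbit (r i) τ) (h ▸ cosetMap_mem_orbit (q j) (hq j) c)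
      rw [hcr, hcq] at this
      omega
    have hpq : ∀ i c j c', cosetMap (p i) (hp i) c ≠ cosetMap (q j) (hq j) c' :=
      fun i c j c' h => by
      have := hsep (cosetMap_mem_orbit (p i) (hp i) c) (h ▸ cosetMap_mem_orbit (q j) (hq j) c')
      rw [hcp, hcq] at this
      omega
    -- Distinct `p i`, or distinct `q i`, might share an orbit; having at most one of each avoids
    -- this.
    have : Subsingleton (Fin a) := Fin.subsingleton_iff_le_one.2 ha
    have : Subsingleton (Fin b) := Fin.subsingleton_iff_le_one.2 hb
    rintro (⟨i, σ⟩ | ⟨i, c⟩ | ⟨i, c⟩) (⟨j, τ⟩ | ⟨j, c'⟩ | ⟨j, c'⟩) h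
    · have h' : σ • r i = τ • r j := h
      obtain rfl : i = j := hr_inj i j ⟨σ⁻¹ * τ, by
        dsimp only
        rw [mul_smul, ← h', inv_smul_smul]⟩
      have hmem : σ⁻¹ * τ ∈ MulAction.stabilizer S3 (r i) := by
        rw [MulAction.mem_stabilizer_iff, mul_smul, ← h', inv_smul_smul]
      rw [hr, Subgroup.mem_bot, inv_mul_eq_one] at hmem
      rw [hmem]
    · exact (hrp _ _ _ _ h).elim
    · exact (hrq _ _ _ _ h).elim
    · exact (hrp _ _ _ _ h.symm).elim
    · obtain rfl := Subsingleton.elim i j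
      obtain rfl : c = c' := cosetMap_injective (p i) (hp i) h
      rfl
    · exact (hpq _ _ _ _ h).elim
    · exact (hrq _ _ _ _ h.symm).elim
    · exact (hpq _ _ _ _ h.symm).elim
    · obtain rfl := Subsingleton.elim i j
      obtain rfl : c = c' := cosetMap_injective (q i) (hq i) h
      rfl
  have hsurj : Function.Surjective ψ := by
    intro x
    rcases hcover x with hx | ⟨i, σ, rfl⟩ | ⟨i, σ, rfl⟩
    · obtain ⟨i, σ, rfl⟩ := hr_cover x hx
      exact ⟨Sum.inl ⟨i, σ⟩, rfl⟩
    · exact ⟨Sum.inr (Sum.inl ⟨i, (σ : S3 ⧸ C2)⟩), rfl⟩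
    · exact ⟨Sum.inr (Sum.inr ⟨i, (σ : S3 ⧸ C3)⟩), rfl⟩
  let Ψ := Equiv.ofBijective ψ ⟨hinj, hsurj⟩
  have hk : Fintype.card Ω = k := by
    have := Nat.card_congr Ψ
    rw [card_orbitSum, hcard] at this
    omega
  rw [← hk]
  refine ⟨Ψ.symm, fun σ x => ?_⟩
  rw [Equiv.symm_apply_eq]
  calc σ • x = σ • Ψ (Ψ.symm x) := by rw [Equiv.apply_symm_apply]
    _ = Ψ (σ • Ψ.symm x) := (hψ σ (Ψ.symm x)).symm

/-! ### Nontrivial stabilizers up to conjugacy, and the conclusion -/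

theorem exists_conj_of_ne_one :
    ∀ g : S3, g ≠ 1 → ∃ σ : S3, σ * g * σ⁻¹ = Equiv.swap 0 1 ∨ σ * g * σ⁻¹ = finRotate 3 := by
  decide

theorem exists_smul_fixed_of_stabilizer_ne_bot {X : Type*} [MulAction S3 X] {x : X}
    (hx : MulAction.stabilizer S3 x ≠ ⊥) :
    ∃ σ : S3, (Equiv.swap 0 1 : S3) • σ • x = σ • x ∨ (finRotate 3 : S3) • σ • x = σ • x := by
  obtain ⟨⟨g, hg⟩, hne⟩ := Subgroup.ne_bot_iff_exists_ne_one.1 hx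
  have hg1 : g ≠ 1 := fun h => hne (Subtype.ext h)
  rw [MulAction.mem_stabilizer_iff] at hg
  obtain ⟨σ, hσ⟩ := exists_conj_of_ne_one g hg1
  have key : (σ * g * σ⁻¹) • σ • x = σ • x := by
    rw [mul_smul, inv_smul_smul, mul_smul, hg]
  refine ⟨σ, hσ.imp (fun h => ?_) (fun h => ?_)⟩ <;> rwa [h] at key

section SubMulAction

variable {G X : Type*} [Group G] [MulAction G X] (S : SubMulAction G X)

theorem mem_orbit_subMulAction_iff {x y : S} :
    x ∈ MulAction.orbit G y ↔ (x : X) ∈ MulAction.orbit G (y : X) :=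
  exists_congr fun _ => Subtype.ext_iff

end SubMulAction

/-- The orbit structure of a transverse intersection of two symmetric plane curves: `a` records
whether `d * e` is odd and `b` whether it is prime to `3`. -/
theorem isomorphic_intersectionLocus {d e : ℕ} (hd : 1 ≤ d) (he : 1 ≤ e)
    {f g : MvPolynomial (Fin 3) ℂ} (hf0 : f ≠ 0) (hg0 : g ≠ 0)
    (hfd : f.IsHomogeneous d) (hge : g.IsHomogeneous e)
    (hf : f.IsSymmetric) (hg : g.IsSymmetric) (hfg : Transverse f g) {k a b : ℕ}
    (hk : d * e = 6 * k + 3 * a + 2 * b) (ha : a ≤ 1) (hb : b ≤ 1) :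
    Isomorphic (intersectionLocus f g hf hg) (OrbitSum k a b) := by
  have hω := Complex.isPrimitiveRoot_exp 3 (by norm_num)
  set ω := Complex.exp (2 * Real.pi * Complex.I / (3 : ℕ)) with hω'
  obtain ⟨hfin, hcard⟩ := hfg.finite_and_ncard_eq hfd hge hf0 hg0
  have : Finite (intersectionLocus f g hf hg) := hfin
  -- By `hk`, `a` has the parity of `d * e`, and `d * e ≡ 2 * b mod 3`; as both are at most `1`,
  -- they are determined by `d * e`.
  have hp : 0 < a → antiPoint ∈ intersectionLocus f g hf hg := fun ha' => by
    have hodd : Odd (d * e) := by rw [Nat.odd_iff]; omega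
    rw [Nat.odd_mul] at hodd
    exact ⟨antiPoint_mem_zeroLocus hf hfd hodd.1, antiPoint_mem_zeroLocus hg hge hodd.2⟩
  have hq : 0 < b → cyclicPoint ω ∈ intersectionLocus f g hf hg := fun hb' => by
    have h3 : ¬ 3 ∣ d * e := by omega
    exact ⟨cyclicPoint_mem_zeroLocus hω hf hfd fun h => h3 (h.mul_right e),
      cyclicPoint_mem_zeroLocus hω hg hge fun h => h3 (h.mul_left d)⟩
  refine isomorphic_orbitSum (hcard.trans hk) ha hb
    (fun i => ⟨antiPoint, hp (Nat.zero_lt_of_lt i.2)⟩) (fun i => ?_)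
    (fun i => ⟨cyclicPoint ω, hq (Nat.zero_lt_of_lt i.2)⟩) (fun i => ?_) fun x => ?_
  · rw [SubMulAction.stabilizer_of_subMul]
    exact stabilizer_antiPoint
  · rw [SubMulAction.stabilizer_of_subMul]
    exact stabilizer_cyclicPoint hω
  · refine or_iff_not_imp_left.2 fun hx => ?_
    obtain ⟨σ, hσ⟩ := exists_smul_fixed_of_stabilizer_ne_bot hx
    have hmem := (σ • x).2
    refine hσ.imp (fun h => ?_) (fun h => ?_)
    · obtain ⟨h1, h2⟩ := eq_antiPoint_of_swap_smul hd he hfd hge hf hg hfg hmem.1 hmem.2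
        (congrArg Subtype.val h)
      have : 0 < a := by rw [Nat.odd_iff] at h2; omega
      refine ⟨⟨0, this⟩, (mem_orbit_subMulAction_iff _).2 ⟨σ⁻¹, ?_⟩⟩
      change σ⁻¹ • antiPoint = x.1
      rw [← h1]
      exact inv_smul_smul σ x.1
    · obtain ⟨⟨τ, h1⟩, h2⟩ := mem_orbit_cyclicPoint_of_finRotate_smul hω hd he hfd hge hf hg hfg
        hmem.1 hmem.2 (congrArg Subtype.val h)
      have : 0 < b := by omega
      refine ⟨⟨0, this⟩, (mem_orbit_subMulAction_iff _).2 ⟨σ⁻¹ * τ, ?_⟩⟩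
      change (σ⁻¹ * τ) • cyclicPoint ω = x.1
      rw [mul_smul, show τ • cyclicPoint ω = σ • x.1 from h1, inv_smul_smul]

/-- If `3 ∤ d * e`, the cyclic point is a common point fixed by the 3-cycle, which forces residue
`2`. -/
theorem mul_mod_three_ne_one {d e : ℕ} (hd : 1 ≤ d) (he : 1 ≤ e)
    {f g : MvPolynomial (Fin 3) ℂ} (hfd : f.IsHomogeneous d) (hge : g.IsHomogeneous e)
    (hf : f.IsSymmetric) (hg : g.IsSymmetric) (hfg : Transverse f g) : d * e % 3 ≠ 1 := by
  intro h
  have hω := Complex.isPrimitiveRoot_exp 3 (by norm_num)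
  have h3 : ¬ 3 ∣ d * e := by omega
  have := (mem_orbit_cyclicPoint_of_finRotate_smul hω hd he hfd hge hf hg hfg
    (cyclicPoint_mem_zeroLocus hω hf hfd fun h => h3 (h.mul_right e))
    (cyclicPoint_mem_zeroLocus hω hg hge fun h => h3 (h.mul_left d))
    (finRotate_smul_cyclicPoint hω.pow_eq_one)).2
  omega

end SymmetricBezout

theorem mainTheorem1 (d e : ℕ) (hd : 1 ≤ d) (he : 1 ≤ e) (f g : MvPolynomial (Fin 3) ℂ)
    (hf0 : f ≠ 0) (hg0 : g ≠ 0)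
    (hfd : f.IsHomogeneous d) (hge : g.IsHomogeneous e)
    (hf : f.IsSymmetric) (hg : g.IsSymmetric)
    (hfg : SymmetricBezout.Transverse f g) :
    ∀ k : ℕ,
      (d * e = 6 * k →
        SymmetricBezout.Isomorphic (SymmetricBezout.intersectionLocus f g hf hg)
          (SymmetricBezout.OrbitSum k 0 0)) ∧
      d * e ≠ 6 * k + 1 ∧
      (d * e = 6 * k + 2 →
        SymmetricBezout.Isomorphic (SymmetricBezout.intersectionLocus f g hf hg)
          (SymmetricBezout.OrbitSum k 0 1)) ∧
      (d * e = 6 * k + 3 →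
        SymmetricBezout.Isomorphic (SymmetricBezout.intersectionLocus f g hf hg)
          (SymmetricBezout.OrbitSum k 1 0)) ∧
      d * e ≠ 6 * k + 4 ∧
      (d * e = 6 * k + 5 →
        SymmetricBezout.Isomorphic (SymmetricBezout.intersectionLocus f g hf hg)
          (SymmetricBezout.OrbitSum k 1 1)) := by
  intro k
  have h3 := SymmetricBezout.mul_mod_three_ne_one hd he hfd hge hf hg hfg
  refine ⟨fun h => ?_, by omega, fun h => ?_, fun h => ?_, by omega, fun h => ?_⟩ <;>
    exact SymmetricBezout.isomorphic_intersectionLocus hd he hf0 hg0 hfd hge hf hg hfg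
      (by omega) (by omega) (by omega)
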